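/- Let $H$ be a finite bipartite multigraph with parts $X$ and $Y$ and at least one edge, let $L(H)$ be its line graph (vertices: the edges of $H$; two distinct edges are adjacent iff they have at least one common end), and let $G=\overline{L(H)}$ be the complement of $L(H)$; graphs of this form are called skew graphs. Represent $G$ by the table with rows indexed by $X$ and columns indexed by $Y$, in which an edge of $H$ joining $x\in X$ and $y\in Y$ is placed, as a vertex of $G$, in the box $(x,y)$; thus two vertices of $G$ are adjacent iff they lie in different rows and in different columns. For a row $R$ (column $C$) let $V(R)$ (resp. $V(C)$) be the set of vertices of $G$ placed in it, let $|G|$ be the number of vertices of $G$, and put $$DF(G)=\max\bigl(\{|G|\}\cup\{2|V(R)|-1\}_{R}\cup\{2|V(C)|-1\}_{C}\cup\{|V(R)|+|V(C)| : V(R)\not\subseteq V(C),\ V(C)\not\subseteq V(R)\}\bigr)-|G|,$$ where $R$ runs over all rows and $C$ over all columns. Let $\pi(G)$ be the smallest number of pairwise vertex-disjoint paths (single vertices allowed) covering all vertices of $G$, and let $\lambda_{2,1}(F)$ be the least $k$ such that the vertices of the graph $F$ can be labeled from $\{0,1,\dots,k\}$ so that labels of adjacent vertices differ by at least $2$ and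 vertices at distance two get different labels. (a) Suppose that the table is not of the following exceptional form: it has exactly four nonempty boxes, these are the intersections of two rows with two columns, and the two boxes on each diagonal of this $2\times 2$ square contain equally many vertices. Then $\pi(G)=DF(G)+1$. (b) If $DF(G)\ge 1$, then $\lambda_{2,1}(L(H))=|G|+DF(G)-1$. -/

import Mathlib

/-- `G` has a family of exactly `k` pairwise vertex-disjoint paths (one-vertex paths allowed)
that covers all vertices. -/
def SimpleGraph.HasPathCover {V : Type*} (G : SimpleGraph V) (k : ℕ) : Prop :=
  ∃ (a b : Fin k → V) (p : ∀ i, G.Walk (a i) (b i)),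
    (∀ i, (p i).IsPath) ∧
    (∀ i j, i ≠ j → List.Disjoint (p i).support (p j).support) ∧
    ∀ v, ∃ i, v ∈ (p i).support

/-- The path covering number `π(G)`: the least number of pairwise vertex-disjoint paths that
cover the vertices of `G`. -/
noncomputable def SimpleGraph.pathCoveringNumber {V : Type*} (G : SimpleGraph V) : ℕ :=
  sInf {k | G.HasPathCover k}

/-- On a finite graph the infimum defining the path covering number is over a nonempty set. -/
theorem SimpleGraph.exists_hasPathCover {V : Type*} [Fintype V] (G : SimpleGraph V) :
    ∃ k, G.HasPathCover k := by
  let e := (Fintype.equivFin V).symm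
  refine ⟨Fintype.card V, e, e, fun i => SimpleGraph.Walk.nil, fun i => by simp, ?_, ?_⟩
  · intro i j hij
    simpa [eq_comm] using hij
  · intro v
    exact ⟨e.symm v, by simp⟩

/-- An `L(p,q)`-labeling: labels of adjacent vertices differ by at least `p`, labels of vertices
at distance two differ by at least `q`. -/
def SimpleGraph.IsLLabeling {V : Type*} (G : SimpleGraph V) (p q : ℕ) (f : V → ℕ) : Prop :=
  (∀ u v, G.Adj u v → (p : ℤ) ≤ |(f u : ℤ) - (f v : ℤ)|) ∧
  (∀ u v, G.dist u v = 2 → (q : ℤ) ≤ |(f u : ℤ) - (f v : ℤ)|)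

/-- `λ_{2,1}(G)`: the least `k` for which there is an `L(2,1)`-labeling with labels from
`{0, 1, …, k}`. -/
noncomputable def SimpleGraph.lambdaTwoOne {V : Type*} (G : SimpleGraph V) : ℕ :=
  sInf {k | ∃ f : V → ℕ, (∀ v, f v ≤ k) ∧ G.IsLLabeling 2 1 f}

/-- A bipartite multigraph with parts `X` and `Y` and edge set `E`: every edge has one end in `X`
and one end in `Y`; parallel edges are allowed. -/
structure BipartiteMultigraph (X Y E : Type*) where
  left : E → X
  right : E → Y

namespace BipartiteMultigraph

variable {X Y E : Type*}

/-- The line graph: distinct edges are adjacent when they share at least one end. -/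
def lineGraph (H : BipartiteMultigraph X Y E) : SimpleGraph E where
  Adj e f := e ≠ f ∧ (H.left e = H.left f ∨ H.right e = H.right f)
  symm := ⟨fun _ _ h => ⟨h.1.symm, h.2.imp Eq.symm Eq.symm⟩⟩
  loopless := ⟨fun _ h => h.1 rfl⟩

/-- The skew graph of `H` is the complement of its line graph. Its table has a row for each
`x : X` and a column for each `y : Y`; the vertex `e` lies in the box `(H.left e, H.right e)`. -/
def skewGraph (H : BipartiteMultigraph X Y E) : SimpleGraph E :=
  H.lineGraphᶜ

theorem skewGraph_adj (H : BipartiteMultigraph X Y E) (e f : E) :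
    H.skewGraph.Adj e f ↔ H.left e ≠ H.left f ∧ H.right e ≠ H.right f := by
  simp only [skewGraph, lineGraph, SimpleGraph.compl_adj]
  constructor
  · rintro ⟨h, h'⟩
    exact ⟨fun hl => h' ⟨h, Or.inl hl⟩, fun hr => h' ⟨h, Or.inr hr⟩⟩
  · rintro ⟨hl, hr⟩
    exact ⟨fun h => hl (h ▸ rfl), fun h => h.2.elim hl hr⟩

open scoped Classical in
/-- The set `V(R)` of vertices in the row `x` of the table. -/
noncomputable def row [Fintype E] (H : BipartiteMultigraph X Y E) (x : X) : Finset E :=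
  Finset.univ.filter fun e => H.left e = x

open scoped Classical in
/-- The set `V(C)` of vertices in the column `y` of the table. -/
noncomputable def col [Fintype E] (H : BipartiteMultigraph X Y E) (y : Y) : Finset E :=
  Finset.univ.filter fun e => H.right e = y

open scoped Classical in
/-- The entry of the table in the box `(x, y)`, i.e. the number of edges between `x` and `y`. -/
noncomputable def mult [Fintype E] (H : BipartiteMultigraph X Y E) (x : X) (y : Y) : ℕ :=
  (Finset.univ.filter fun e => H.left e = x ∧ H.right e = y).card

open scoped Classical in
/-- The numbers `2|V(R)| - 1`, `2|V(C)| - 1`, and `|V(R)| + |V(C)|` for those pairs `(R, C)` in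
which neither of `V(R)`, `V(C)` contains the other. -/
noncomputable def deficitTerms [Fintype X] [Fintype Y] [Fintype E]
    (H : BipartiteMultigraph X Y E) : Finset ℤ :=
  (Finset.univ.image fun x : X => 2 * ((H.row x).card : ℤ) - 1) ∪
  (Finset.univ.image fun y : Y => 2 * ((H.col y).card : ℤ) - 1) ∪
  ((Finset.univ.filter fun q : X × Y => ¬ H.row q.1 ⊆ H.col q.2 ∧ ¬ H.col q.2 ⊆ H.row q.1).image
    fun q => ((H.row q.1).card : ℤ) + ((H.col q.2).card : ℤ))

/-- The deficit `DF(G)` of the skew graph `G` of `H`: the maximum of `|G|` and the deficit terms,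
minus `|G|`. (Including `|G|` makes `DF(G) = 0` when no term exceeds `|G|`.) -/
noncomputable def deficit [Fintype X] [Fintype Y] [Fintype E]
    (H : BipartiteMultigraph X Y E) : ℤ :=
  (insert (Fintype.card E : ℤ) H.deficitTerms).max' (Finset.insert_nonempty _ _) - Fintype.card E

/-- The table has exactly four nonempty boxes, forming a rectangle, and the two entries on each
diagonal of the rectangle are equal. -/
def IsBalancedSquare [Fintype E] (H : BipartiteMultigraph X Y E) : Prop :=
  ∃ (x₁ x₂ : X) (y₁ y₂ : Y), x₁ ≠ x₂ ∧ y₁ ≠ y₂ ∧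
    (∀ x y, 0 < H.mult x y ↔ (x = x₁ ∨ x = x₂) ∧ (y = y₁ ∨ y = y₂)) ∧
    H.mult x₁ y₁ = H.mult x₂ y₂ ∧ H.mult x₁ y₂ = H.mult x₂ y₁

end BipartiteMultigraph

/-- The number of elements of `S` lying in the fibre of `g` over `z`. -/
def fiberCard {E Z : Type*} [DecidableEq Z] (g : E → Z) (S : Finset E) (z : Z) : ℕ :=
  (S.filter fun e => g e = z).card

namespace Table

section Fiber

variable {E Z : Type*} [DecidableEq Z] {g : E → Z} {S : Finset E}

theorem fiberCard_pos {e : E} (he : e ∈ S) : 0 < fiberCard g S (g e) :=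
  Finset.card_pos.2 ⟨e, by simp [he]⟩

theorem fiberCard_add_le {z₁ z₂ : Z} (h : z₁ ≠ z₂) :
    fiberCard g S z₁ + fiberCard g S z₂ ≤ S.card := by
  classical
  unfold fiberCard
  rw [← Finset.card_union_of_disjoint]
  · exact Finset.card_le_card (by intro e; simp; tauto)
  · rw [Finset.disjoint_filter]
    rintro e - rfl
    exact h

theorem fiberCard_add_add_le {z₁ z₂ z₃ : Z} (h₁ : z₁ ≠ z₂) (h₂ : z₁ ≠ z₃) (h₃ : z₂ ≠ z₃) :
    fiberCard g S z₁ + fiberCard g S z₂ + fiberCard g S z₃ ≤ S.card := by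
  classical
  unfold fiberCard
  rw [← Finset.card_union_of_disjoint, ← Finset.card_union_of_disjoint]
  · exact Finset.card_le_card (by intro e; simp; tauto)
  · rw [← Finset.filter_or, Finset.disjoint_filter]
    rintro e - (rfl | rfl) <;> assumption
  · rw [Finset.disjoint_filter]
    rintro e - rfl
    exact h₁

theorem eq_or_eq_of_le_fiberCard_add {z₁ z₂ : Z} (h : z₁ ≠ z₂)
    (hS : S.card ≤ fiberCard g S z₁ + fiberCard g S z₂) {e : E} (he : e ∈ S) :
    g e = z₁ ∨ g e = z₂ := by
  by_contra! hne
  have h1 := fiberCard_add_add_le (g := g) (S := S) h hne.1.symm hne.2.symm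
  have h2 := fiberCard_pos (g := g) he
  omega

theorem fiberCard_erase [DecidableEq E] {f : E} (hf : f ∈ S) (z : Z) :
    fiberCard g (S.erase f) z + (if g f = z then 1 else 0) = fiberCard g S z := by
  unfold fiberCard
  rw [Finset.filter_erase]
  split_ifs with h
  · rw [Finset.card_erase_add_one (by simp [hf, h])]
  · rw [Finset.erase_eq_of_notMem (by simp [h]), add_zero]

theorem two_le_fiberCard {a b : E} (ha : a ∈ S) (hb : b ∈ S) (hab : a ≠ b) (h : g a = g b) :
    2 ≤ fiberCard g S (g b) :=
  Finset.one_lt_card.2 ⟨a, by simp [ha, h], b, by simp [hb], hab⟩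

theorem fiberCard_eq_one {f : E} (hf : f ∈ S) (h : ∀ p ∈ S, g p = g f → p = f) :
    fiberCard g S (g f) = 1 :=
  Finset.card_eq_one.2 ⟨f, by ext p; simp; exact ⟨fun hp => h p hp.1 hp.2, by rintro rfl; simp [hf]⟩⟩

theorem exists_mem_of_fiberCard_lt {Z' : Type*} [DecidableEq Z'] {g' : E → Z'} {z : Z} {z' : Z'}
    (h : fiberCard g' S z' < fiberCard g S z) : ∃ p ∈ S, g p = z ∧ g' p ≠ z' := by
  by_contra! hne
  refine absurd (Finset.card_le_card ?_) (not_le.2 h)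
  intro p
  simp only [Finset.mem_filter]
  exact fun hp => ⟨hp.1, hne p hp.1 hp.2⟩

theorem fiberCard_le_card (z : Z) : fiberCard g S z ≤ S.card := Finset.card_filter_le _ _

theorem exists_mem_of_fiberCard_le {Z' : Type*} [DecidableEq Z'] {g' : E → Z'} {z : Z} {z' : Z'}
    (h : fiberCard g' S z' ≤ fiberCard g S z) (hsub : ∀ p ∈ S, g p = z → g' p = z') :
    ∀ p ∈ S, g' p = z' → g p = z := by
  have := Finset.eq_of_subset_of_card_le (s := S.filter fun p => g p = z)
    (t := S.filter fun p => g' p = z') (by intro p; simp; exact fun hp h => ⟨hp, hsub p hp h⟩) h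
  intro p hp hpz
  have hmem : p ∈ S.filter fun p => g' p = z' := by simp [hp, hpz]
  rw [← this] at hmem
  exact (Finset.mem_filter.1 hmem).2

theorem fiberCard_add_le_of_forall_not {Z' : Type*} [DecidableEq Z'] {g' : E → Z'} {z : Z} {z' : Z'}
    (h : ∀ p ∈ S, g p = z → g' p ≠ z') : fiberCard g S z + fiberCard g' S z' ≤ S.card := by
  classical
  unfold fiberCard
  rw [← Finset.card_union_of_disjoint]
  · exact Finset.card_le_card (by intro e; simp; tauto)
  · rwa [Finset.disjoint_filter]

theorem fiberCard_map_inl [Fintype E] (g : E → Z) (d : ℕ)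
    (z : Z) : fiberCard (Sum.map g (Fin.val (n := d))) Finset.univ (Sum.inl z) =
      fiberCard g Finset.univ z := by
  classical
  unfold fiberCard
  refine Eq.trans ?_ (Finset.card_map (Function.Embedding.inl : E ↪ E ⊕ Fin d))
  congr 1
  ext (e | i) <;> simp

theorem fiberCard_map_inr_le [Fintype E] (g : E → Z) (d : ℕ)
    (i : ℕ) : fiberCard (Sum.map g (Fin.val (n := d))) Finset.univ (Sum.inr i) ≤ 1 := by
  classical
  unfold fiberCard
  rw [Finset.card_le_one]
  rintro (a | a) ha (b | b) hb <;> simp at ha hb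
  rw [Fin.ext (ha.trans hb.symm)]

theorem fiberCard_map_inr_self [Fintype E] (g : E → Z) (d : ℕ) :
    fiberCard (Sum.map g (Fin.val (n := d))) Finset.univ (Sum.inr d) = 0 := by
  classical
  unfold fiberCard
  rw [Finset.card_eq_zero, Finset.filter_eq_empty_iff]
  rintro (a | a) - <;> simp
  exact a.2.ne

end Fiber

variable {X Y E : Type*} {l : E → X} {r : E → Y} {S : Finset E}

/-- Neither of the row `x` and the column `y` contains the other. -/
def Incomparable (l : E → X) (r : E → Y) (S : Finset E) (x : X) (y : Y) : Prop :=
  (∃ p ∈ S, l p = x ∧ r p ≠ y) ∧ ∃ q ∈ S, r q = y ∧ l q ≠ x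

/-- The nonempty boxes are the intersections of two rows with two columns. -/
def IsFullSquare (l : E → X) (r : E → Y) (S : Finset E) : Prop :=
  ∃ x₁ x₂ y₁ y₂, x₁ ≠ x₂ ∧ y₁ ≠ y₂ ∧
    (∀ p ∈ S, (l p = x₁ ∨ l p = x₂) ∧ (r p = y₁ ∨ r p = y₂)) ∧
    ∀ x y, (x = x₁ ∨ x = x₂) → (y = y₁ ∨ y = y₂) → ∃ p ∈ S, l p = x ∧ r p = y

theorem Incomparable.swap {x : X} {y : Y} (h : Incomparable l r S x y) :
    Incomparable r l S y x := ⟨h.2, h.1⟩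

theorem IsFullSquare.swap (h : IsFullSquare l r S) : IsFullSquare r l S := by
  obtain ⟨x₁, x₂, y₁, y₂, hx, hy, h1, h2⟩ := h
  refine ⟨y₁, y₂, x₁, x₂, hy, hx, fun p hp => (h1 p hp).symm, fun y x hy hx => ?_⟩
  obtain ⟨p, hp, h⟩ := h2 x y hx hy
  exact ⟨p, hp, h.symm⟩

theorem Incomparable.of_erase [DecidableEq E] {f : E} {x : X} {y : Y} (h : Incomparable l r (S.erase f) x y) :
    Incomparable l r S x y := by
  obtain ⟨⟨p, hp, h1⟩, q, hq, h2⟩ := h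
  exact ⟨⟨p, Finset.mem_of_mem_erase hp, h1⟩, q, Finset.mem_of_mem_erase hq, h2⟩

variable [DecidableEq X] [DecidableEq Y]

/-- The table has deficit zero and is not a full square. -/
structure IsGood (l : E → X) (r : E → Y) (S : Finset E) : Prop where
  row : ∀ x, 2 * fiberCard l S x ≤ S.card + 1
  col : ∀ y, 2 * fiberCard r S y ≤ S.card + 1
  pair : ∀ x y, Incomparable l r S x y → fiberCard l S x + fiberCard r S y ≤ S.card
  not_square : ¬ IsFullSquare l r S

/-- A Hamiltonian path of a good table can be preceded by a vertex in the box `(x, y)`. -/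
structure IsStart (l : E → X) (r : E → Y) (S : Finset E) (x : X) (y : Y) : Prop where
  row : 2 * fiberCard l S x ≤ S.card
  col : 2 * fiberCard r S y ≤ S.card
  pair : Incomparable l r S x y → fiberCard l S x + fiberCard r S y < S.card
  cols : ∀ y₁ y₂, y₁ ≠ y₂ → Incomparable l r S x y₁ → Incomparable l r S x y₂ →
    fiberCard l S x + fiberCard r S y₁ = S.card → fiberCard l S x + fiberCard r S y₂ ≠ S.card
  rows : ∀ x₁ x₂, x₁ ≠ x₂ → Incomparable l r S x₁ y → Incomparable l r S x₂ y →
    fiberCard l S x₁ + fiberCard r S y = S.card → fiberCard l S x₂ + fiberCard r S y ≠ S.card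

/-- The vertex `f` meets every row and column pair whose size allows no vertex to be skipped. -/
def MeetsTightPairs (l : E → X) (r : E → Y) (S : Finset E) (f : E) : Prop :=
  ∀ x y, Incomparable l r S x y → fiberCard l S x + fiberCard r S y = S.card → l f = x ∨ r f = y

theorem IsGood.swap (h : IsGood l r S) : IsGood r l S where
  row := h.col
  col := h.row
  pair y x hi := by rw [add_comm]; exact h.pair x y hi.swap
  not_square hs := h.not_square hs.swap

theorem IsStart.swap {x : X} {y : Y} (h : IsStart l r S x y) : IsStart r l S y x where
  row := h.col
  col := h.row
  pair hi := by rw [add_comm]; exact h.pair hi.swap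
  cols x₁ x₂ hx h₁ h₂ := by
    rw [add_comm, add_comm (fiberCard r S y)]; exact h.rows x₁ x₂ hx h₁.swap h₂.swap
  rows y₁ y₂ hy h₁ h₂ := by
    rw [add_comm, add_comm (fiberCard r S y₂)]; exact h.cols y₁ y₂ hy h₁.swap h₂.swap

theorem MeetsTightPairs.swap {f : E} (h : MeetsTightPairs l r S f) : MeetsTightPairs r l S f :=
  fun y x hi hc => (h x y hi.swap (by rw [add_comm]; exact hc)).symm

/-- When no line is large, some admissible vertex meets all tight pairs, provided these share
a row. -/
theorem exists_meetsTightPairs_of_row {x : X} {y : Y} (hs : IsStart l r S x y)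
    (hrow : ∀ x, 2 * fiberCard l S x ≤ S.card)
    {x₀ : X} {y₀ : Y} (hi : Incomparable l r S x₀ y₀)
    (he : fiberCard l S x₀ + fiberCard r S y₀ = S.card)
    (hall : ∀ x' y', Incomparable l r S x' y' →
      fiberCard l S x' + fiberCard r S y' = S.card → x' = x₀) :
    ∃ f ∈ S, l f ≠ x ∧ r f ≠ y ∧ MeetsTightPairs l r S f := by
  by_cases hex : x ≠ x₀ ∧ ∃ f ∈ S, l f = x₀ ∧ r f ≠ y
  · obtain ⟨hx, f, hf, hf1, hf2⟩ := hex
    refine ⟨f, hf, by rw [hf1]; exact hx.symm, hf2, fun x' y' hi' he' => .inl ?_⟩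
    rw [hf1, hall x' y' hi' he']
  obtain ⟨⟨p, hp, hp1, hp2⟩, q, hq, hq1, hq2⟩ := id hi
  by_cases huniq : ∀ y', Incomparable l r S x₀ y' →
      fiberCard l S x₀ + fiberCard r S y' = S.card → y' = y₀
  · have hyy : y₀ ≠ y := by
      rintro rfl
      by_cases hx : x = x₀
      · subst hx
        have := hs.pair hi
        omega
      · exact hex ⟨hx, p, hp, hp1, hp2⟩
    obtain ⟨f, hf, hf1, hf2⟩ : ∃ f ∈ S, r f = y₀ ∧ l f ≠ x := by
      by_cases hx : x = x₀
      · exact ⟨q, hq, hq1, by rwa [hx]⟩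
      · by_contra! hsub
        have hsub' : ∀ f ∈ S, l f = x₀ → r f = y := by
          by_contra! hcon
          exact hex ⟨hx, hcon⟩
        have h1 : fiberCard l S x₀ ≤ fiberCard r S y := Finset.card_le_card (by
          intro p; simp; exact fun hp h => ⟨hp, hsub' p hp h⟩)
        have h2 : fiberCard r S y₀ ≤ fiberCard l S x := Finset.card_le_card (by
          intro p; simp; exact fun hp h => ⟨hp, hsub p hp h⟩)
        have := hs.pair ⟨⟨q, hq, hsub q hq hq1, by rwa [hq1]⟩, p, hp, hsub' p hp hp1,
          by rw [hp1]; exact fun h => hx h.symm⟩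
        omega
    refine ⟨f, hf, hf2, by rwa [hf1], fun x' y' hi' he' => .inr ?_⟩
    obtain rfl := hall x' y' hi' he'
    rw [hf1, huniq y' hi' he']
  · exfalso
    push Not at huniq
    obtain ⟨y₁, hi₁, he₁, hy⟩ := huniq
    by_cases hx : x = x₀
    · subst hx
      exact hs.cols y₁ y₀ hy hi₁ hi he₁ he
    · have hsub' : ∀ f ∈ S, l f = x₀ → r f = y := by
        by_contra! hcon
        exact hex ⟨hx, hcon⟩
      obtain ⟨⟨p', hp', hp1', hp2'⟩, -⟩ := hi₁
      obtain rfl := hsub' p hp hp1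
      have h1 := hsub' p' hp' hp1'
      have h2 := fiberCard_add_add_le (g := r) (S := S) hy (by rw [← h1]; exact hp2'.symm) hp2.symm
      have h3 := fiberCard_pos (g := r) hp
      have := hrow x₀
      omega

/-- When no line is large, some admissible vertex meets all tight pairs. -/
theorem exists_meetsTightPairs {x : X} {y : Y} (h : IsGood l r S) (hs : IsStart l r S x y)
    (hS : S.Nonempty) (hrow : ∀ x, 2 * fiberCard l S x ≤ S.card)
    (hcol : ∀ y, 2 * fiberCard r S y ≤ S.card) :
    ∃ f ∈ S, l f ≠ x ∧ r f ≠ y ∧ MeetsTightPairs l r S f := by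
  classical
  have hadm : ∃ f ∈ S, l f ≠ x ∧ r f ≠ y := by
    by_contra! hcov
    have hpos := hS.card_pos
    by_cases hi : Incomparable l r S x y
    · have h1 := hs.pair hi
      have h2 : S.card ≤ fiberCard l S x + fiberCard r S y := by
        refine le_trans (Finset.card_le_card ?_) (Finset.card_union_le _ _)
        intro p hp
        have := hcov p hp
        simp only [Finset.mem_union, Finset.mem_filter]
        tauto
      omega
    · unfold Incomparable at hi
      rw [not_and_or] at hi
      push Not at hi
      rcases hi with hi | hi
      · have h1 : S.card ≤ fiberCard r S y := Finset.card_le_card (by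
          intro p hp
          have := hcov p hp
          have := hi p hp
          simp only [Finset.mem_filter]
          tauto)
        have := hs.col
        omega
      · have h1 : S.card ≤ fiberCard l S x := Finset.card_le_card (by
          intro p hp
          have := hcov p hp
          have := hi p hp
          simp only [Finset.mem_filter]
          tauto)
        have := hs.row
        omega
  by_cases hcross : ∃ x₀ x₁ y₀ y₁, x₀ ≠ x₁ ∧ y₀ ≠ y₁ ∧ Incomparable l r S x₀ y₀ ∧
      Incomparable l r S x₁ y₁ ∧ fiberCard l S x₀ + fiberCard r S y₀ = S.card ∧
      fiberCard l S x₁ + fiberCard r S y₁ = S.card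
  · obtain ⟨x₀, x₁, y₀, y₁, hx, hy, hi₀, hi₁, e₀, e₁⟩ := hcross
    have a1 := hrow x₀
    have a2 := hrow x₁
    have a3 := hcol y₀
    have a4 := hcol y₁
    have hl : ∀ p ∈ S, l p = x₀ ∨ l p = x₁ := fun p hp =>
      eq_or_eq_of_le_fiberCard_add hx (by omega) hp
    have hr : ∀ p ∈ S, r p = y₀ ∨ r p = y₁ := fun p hp =>
      eq_or_eq_of_le_fiberCard_add hy (by omega) hp
    obtain ⟨⟨p, hp, hp1, hp2⟩, q, hq, hq1, hq2⟩ := id hi₀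
    have hp3 : r p = y₁ := (hr p hp).resolve_left hp2
    have hq3 : l q = x₁ := (hl q hq).resolve_left hq2
    have hdiag : ¬ ((∃ a ∈ S, l a = x₀ ∧ r a = y₀) ∧ ∃ d ∈ S, l d = x₁ ∧ r d = y₁) := by
      rintro ⟨⟨a, ha, ha'⟩, d, hd, hd'⟩
      refine h.not_square ⟨x₀, x₁, y₀, y₁, hx, hy, fun p hp => ⟨hl p hp, hr p hp⟩, ?_⟩
      rintro x y (rfl | rfl) (rfl | rfl)
      exacts [⟨a, ha, ha'⟩, ⟨p, hp, hp1, hp3⟩, ⟨q, hq, hq3, hq1⟩, ⟨d, hd, hd'⟩]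
    have hoff : ∀ p ∈ S, (l p = x₀ → r p = y₁) ∧ (l p = x₁ → r p = y₀) := by
      by_cases ha : ∃ a ∈ S, l a = x₀ ∧ r a = y₀
      · have hd : ∀ d ∈ S, l d = x₁ → r d = y₀ := fun d hd hd1 =>
          (hr d hd).resolve_right fun hd2 => hdiag ⟨ha, d, hd, hd1, hd2⟩
        have hd' := exists_mem_of_fiberCard_le (g := l) (g' := r) (S := S) (by omega) hd
        obtain ⟨a, haS, ha1, ha2⟩ := ha
        exact absurd (ha1.symm.trans (hd' a haS ha2)) hx
      · push Not at ha
        have hd : ∀ d ∈ S, l d = x₀ → r d = y₁ := fun d hd hd1 =>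
          (hr d hd).resolve_left (ha d hd hd1)
        have hd' := exists_mem_of_fiberCard_le (g := l) (g' := r) (S := S) (by omega) hd
        refine fun p hp => ⟨hd p hp, fun hp1 => (hr p hp).resolve_right fun hp2 => ?_⟩
        exact hx ((hd' p hp hp2).symm.trans hp1)
    obtain ⟨f, hf, hf1, hf2⟩ := hadm
    refine ⟨f, hf, hf1, hf2, fun x' y' hi' he' => ?_⟩
    obtain ⟨⟨s, hs, rfl, hs2⟩, t, ht, rfl, ht2⟩ := hi'
    have b1 := hoff s hs
    have b2 := hoff t ht
    have b3 := hoff f hf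
    have c1 := hl s hs
    have c2 := hl t ht
    have c3 := hl f hf
    grind
  by_cases hany : ∃ x₀ y₀, Incomparable l r S x₀ y₀ ∧
      fiberCard l S x₀ + fiberCard r S y₀ = S.card
  · obtain ⟨x₀, y₀, hi₀, he₀⟩ := hany
    by_cases hallx : ∀ x' y', Incomparable l r S x' y' →
        fiberCard l S x' + fiberCard r S y' = S.card → x' = x₀
    · exact exists_meetsTightPairs_of_row hs hrow hi₀ he₀ hallx
    · push Not at hallx
      obtain ⟨x₁, y₁, hi₁, he₁, hx⟩ := hallx
      have hy : y₁ = y₀ := by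
        by_contra hy
        exact hcross ⟨x₁, x₀, y₁, y₀, hx, hy, hi₁, hi₀, he₁, he₀⟩
      subst hy
      obtain ⟨f, hf, h1, h2, h3⟩ := exists_meetsTightPairs_of_row hs.swap hcol hi₀.swap
        (by rw [add_comm]; exact he₀) (fun y' x' hi' he' => by
          rw [add_comm] at he'
          by_contra hy
          by_cases hx' : x' = x₀
          · subst hx'
            exact hcross ⟨x', x₁, y', y₁, Ne.symm hx, hy, hi'.swap, hi₁, he', he₁⟩
          · exact hcross ⟨x', x₀, y', y₁, hx', hy, hi'.swap, hi₀, he', he₀⟩)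
      exact ⟨f, hf, h2, h1, h3.swap⟩
  · obtain ⟨f, hf, hf1, hf2⟩ := hadm
    exact ⟨f, hf, hf1, hf2, fun x' y' hi' he' => absurd ⟨x', y', hi', he'⟩ hany⟩

variable [DecidableEq E]

/-- Removing a vertex that meets all tight rows, columns and pairs leaves a good table. -/
theorem IsGood.erase {f : E} (hf : f ∈ S) (h : IsGood l r S)
    (hrow : ∀ x, 2 * fiberCard l S x = S.card + 1 → l f = x)
    (hcol : ∀ y, 2 * fiberCard r S y = S.card + 1 → r f = y)
    (hpair : MeetsTightPairs l r S f) (hsq : ¬ IsFullSquare l r (S.erase f)) :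
    IsGood l r (S.erase f) where
  row x := by
    have h1 := fiberCard_erase (g := l) hf x
    have h2 := Finset.card_erase_add_one hf
    have h3 := h.row x
    have h4 := hrow x
    split_ifs at h1 <;> grind
  col y := by
    have h1 := fiberCard_erase (g := r) hf y
    have h2 := Finset.card_erase_add_one hf
    have h3 := h.col y
    have h4 := hcol y
    split_ifs at h1 <;> grind
  pair x y hi := by
    have h1 := fiberCard_erase (g := l) hf x
    have h1' := fiberCard_erase (g := r) hf y
    have h2 := Finset.card_erase_add_one hf
    have h3 := h.pair x y hi.of_erase
    have h4 := hpair x y hi.of_erase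
    split_ifs at h1 h1' <;> grind
  not_square := hsq

theorem erase_cols {f : E} (hf : f ∈ S) (h : IsGood l r S) {y₁ y₂ : Y}
    (h₁ : Incomparable l r (S.erase f) (l f) y₁) (h₂ : Incomparable l r (S.erase f) (l f) y₂)
    (e₁ : fiberCard l (S.erase f) (l f) + fiberCard r (S.erase f) y₁ = (S.erase f).card)
    (e₂ : fiberCard l (S.erase f) (l f) + fiberCard r (S.erase f) y₂ = (S.erase f).card) :
    r f ≠ y₁ ∧ r f ≠ y₂ ∧ fiberCard l S (l f) + fiberCard r S y₁ = S.card ∧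
      fiberCard l S (l f) + fiberCard r S y₂ = S.card := by
  have h0 := fiberCard_erase (g := l) hf (l f)
  have h1 := fiberCard_erase (g := r) hf y₁
  have h1' := fiberCard_erase (g := r) hf y₂
  have h2 := Finset.card_erase_add_one hf
  have h3 := h.pair _ _ h₁.of_erase
  have h3' := h.pair _ _ h₂.of_erase
  rw [if_pos rfl] at h0
  split_ifs at h1 h1' <;> grind

theorem isStart_erase {f : E} (hf : f ∈ S) (h : IsGood l r S)
    (hcols : ∀ y₁ y₂, y₁ ≠ y₂ → r f ≠ y₁ → r f ≠ y₂ →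
      Incomparable l r (S.erase f) (l f) y₁ → Incomparable l r (S.erase f) (l f) y₂ →
      fiberCard l S (l f) + fiberCard r S y₁ = S.card →
      fiberCard l S (l f) + fiberCard r S y₂ ≠ S.card)
    (hrows : ∀ x₁ x₂, x₁ ≠ x₂ → l f ≠ x₁ → l f ≠ x₂ →
      Incomparable l r (S.erase f) x₁ (r f) → Incomparable l r (S.erase f) x₂ (r f) →
      fiberCard l S x₁ + fiberCard r S (r f) = S.card →
      fiberCard l S x₂ + fiberCard r S (r f) ≠ S.card) :
    IsStart l r (S.erase f) (l f) (r f) where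
  row := by
    have h0 := fiberCard_erase (g := l) hf (l f)
    have h2 := Finset.card_erase_add_one hf
    have h3 := h.row (l f)
    rw [if_pos rfl] at h0
    omega
  col := by
    have h0 := fiberCard_erase (g := r) hf (r f)
    have h2 := Finset.card_erase_add_one hf
    have h3 := h.col (r f)
    rw [if_pos rfl] at h0
    omega
  pair hi := by
    have h0 := fiberCard_erase (g := l) hf (l f)
    have h1 := fiberCard_erase (g := r) hf (r f)
    have h2 := Finset.card_erase_add_one hf
    have h3 := h.pair _ _ hi.of_erase
    rw [if_pos rfl] at h0 h1
    omega
  cols y₁ y₂ hy h₁ h₂ e₁ e₂ := by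
    obtain ⟨a, b, c, d⟩ := erase_cols hf h h₁ h₂ e₁ e₂
    exact hcols y₁ y₂ hy a b h₁ h₂ c d
  rows x₁ x₂ hx h₁ h₂ e₁ e₂ := by
    obtain ⟨a, b, c, d⟩ := erase_cols hf h.swap h₁.swap h₂.swap
      (by rw [add_comm]; exact e₁) (by rw [add_comm]; exact e₂)
    exact hrows x₁ x₂ hx a b h₁ h₂ (by rw [add_comm]; exact c) (by rw [add_comm]; exact d)

/-- The induction step when some row contains more than half of the vertices. -/
theorem exists_next_of_large_row {x : X} {y : Y} (h : IsGood l r S) (hs : IsStart l r S x y)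
    {x₀ : X} (hx₀ : 2 * fiberCard l S x₀ = S.card + 1) :
    ∃ f ∈ S, l f ≠ x ∧ r f ≠ y ∧ IsGood l r (S.erase f) ∧
      IsStart l r (S.erase f) (l f) (r f) := by
  have hxx : x₀ ≠ x := by
    rintro rfl
    have := hs.row
    omega
  have hne : (S.filter fun e => l e = x₀ ∧ r e ≠ y).Nonempty := by
    obtain ⟨p, hp, h1⟩ := exists_mem_of_fiberCard_lt (g := l) (g' := r) (S := S) (z := x₀) (z' := y)
      (by have := hs.col; omega)
    exact ⟨p, by simpa using ⟨hp, h1⟩⟩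
  obtain ⟨f, hf', hmax⟩ := Finset.exists_max_image _ (fun e => fiberCard r S (r e)) hne
  simp only [Finset.mem_filter, and_imp] at hf' hmax
  obtain ⟨hf, rfl, hfy⟩ := hf'
  have hcol : ∀ y', 2 * fiberCard r S y' = S.card + 1 → r f = y' := by
    intro y' hy'
    by_contra hne
    have hle : fiberCard l S (l f) ≤ fiberCard r S y' := by omega
    have hinc : Incomparable l r S (l f) y' := by
      refine ⟨⟨f, hf, rfl, hne⟩, ?_⟩
      by_contra! hsub
      exact hne (exists_mem_of_fiberCard_le hle hsub f hf rfl)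
    have := h.pair _ _ hinc
    omega
  have hrow : ∀ x', 2 * fiberCard l S x' = S.card + 1 → l f = x' := by
    intro x' hx'
    by_contra hne
    have := fiberCard_add_le (g := l) (S := S) hne
    omega
  have hpair : MeetsTightPairs l r S f := by
    intro x' y' hi he
    by_contra! hne
    have h1 := fiberCard_add_le (g := l) (S := S) hne.1
    have h2 := h.col y'
    exact hne.2 (hcol y' (by omega))
  refine ⟨f, hf, hxx, hfy, h.erase hf hrow hcol hpair ?_, isStart_erase hf h ?_ ?_⟩
  · rintro ⟨x₁, x₂, y₁, y₂, hx, hy, hin, hbox⟩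
    have hlf : l f = x₁ ∨ l f = x₂ := by
      obtain ⟨q, hq, hq1, hq2⟩ := hbox x₁ y₂ (.inl rfl) (.inr rfl)
      obtain ⟨p, hp, hp1, hp2⟩ := hbox x₁ y₁ (.inl rfl) (.inl rfl)
      by_contra! hne
      have h1 : fiberCard l S (l f) = 1 := fiberCard_eq_one hf fun p hp hpf => by
        by_contra hpne
        have := (hin p (Finset.mem_erase.2 ⟨hpne, hp⟩)).1
        rw [hpf] at this
        tauto
      have h2 : 2 ≤ fiberCard l S (l q) := two_le_fiberCard (Finset.mem_of_mem_erase hp)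
        (Finset.mem_of_mem_erase hq) (by rintro rfl; exact hy (hp2 ▸ hq2)) (by rw [hp1, hq1])
      have := fiberCard_le_card (g := l) (S := S) (l q)
      omega
    have hrf : r f ≠ y₁ ∧ r f ≠ y₂ := by
      by_contra hcon
      refine h.not_square ⟨x₁, x₂, y₁, y₂, hx, hy, fun p hp => ?_, fun x y hx hy => ?_⟩
      · by_cases hpf : p = f
        · subst hpf
          exact ⟨hlf, by tauto⟩
        · exact hin p (Finset.mem_erase.2 ⟨hpf, hp⟩)
      · obtain ⟨p, hp, h⟩ := hbox x y hx hy
        exact ⟨p, Finset.mem_of_mem_erase hp, h⟩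
    have h1 : fiberCard r S (r f) = 1 := fiberCard_eq_one hf fun p hp hpf => by
      by_contra hpne
      have := (hin p (Finset.mem_erase.2 ⟨hpne, hp⟩)).2
      rw [hpf] at this
      tauto
    obtain ⟨w, hw, hwy⟩ : ∃ w, (w = y₁ ∨ w = y₂) ∧ w ≠ y := by
      by_cases hy1 : y₁ = y
      · exact ⟨y₂, .inr rfl, fun h => hy (hy1.trans h.symm)⟩
      · exact ⟨y₁, .inl rfl, hy1⟩
    obtain ⟨p, hp, hp1, hp2⟩ := hbox x₁ w (.inl rfl) hw
    obtain ⟨q, hq, hq1, hq2⟩ := hbox x₂ w (.inr rfl) hw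
    obtain ⟨t, ht, ht1, ht2⟩ := hbox (l f) w hlf hw
    have h2 : 2 ≤ fiberCard r S (r q) := two_le_fiberCard (Finset.mem_of_mem_erase hp)
        (Finset.mem_of_mem_erase hq) (by rintro rfl; exact hx (hp1 ▸ hq1)) (by rw [hp2, hq2])
    have h3 := hmax t (Finset.mem_of_mem_erase ht) ht1 (by rwa [ht2])
    rw [ht2, ← hq2] at h3
    omega
  · intro y₁ y₂ hy hf1 hf2 hi1 hi2 e1 e2
    have h1 := fiberCard_add_add_le (g := r) (S := S) hy hf1.symm hf2.symm
    have h0 := fiberCard_pos (g := r) hf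
    have key : ∀ w w', ((w = y₁ ∧ w' = y₂) ∨ (w = y₂ ∧ w' = y₁)) → w ≠ y → False := by
      intro w w' hww hwy
      obtain ⟨⟨p, hp, hp1, hp2⟩, -⟩ : Incomparable l r (S.erase f) (l f) w' := by
        rcases hww with ⟨-, rfl⟩ | ⟨-, rfl⟩ <;> assumption
      obtain ⟨-, q, hq, hq1, hq2⟩ : Incomparable l r (S.erase f) (l f) w := by
        rcases hww with ⟨rfl, -⟩ | ⟨rfl, -⟩ <;> assumption
      have hpw : r p = w := by
        by_contra hpw
        have hpf : r p ≠ r f := by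
          intro hpf
          have := two_le_fiberCard (g := r) (Finset.mem_of_mem_erase hp) hf
            (Finset.ne_of_mem_erase hp) hpf
          omega
        have h4 := fiberCard_pos (g := r) (Finset.mem_of_mem_erase hp)
        have h5 := Finset.card_erase_add_one hf
        have h6 := fiberCard_erase (g := r) hf y₁
        have h7 := fiberCard_erase (g := r) hf y₂
        rw [if_neg hf1] at h6
        rw [if_neg hf2] at h7
        have := eq_or_eq_of_le_fiberCard_add (g := r) hy (by omega) hp
        rcases hww with ⟨rfl, rfl⟩ | ⟨rfl, rfl⟩ <;> tauto
      have h2 : 2 ≤ fiberCard r S (r q) := two_le_fiberCard (Finset.mem_of_mem_erase hp)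
        (Finset.mem_of_mem_erase hq) (by rintro rfl; exact hq2 hp1) (by rw [hpw, hq1])
      have h3 := hmax p (Finset.mem_of_mem_erase hp) hp1 (by rwa [hpw])
      rw [hpw, ← hq1] at h3
      omega
    by_cases hy1 : y₁ = y
    · exact key y₂ y₁ (.inr ⟨rfl, rfl⟩) (fun h => hy (hy1.trans h.symm))
    · exact key y₁ y₂ (.inl ⟨rfl, rfl⟩) hy1
  · intro x₁ x₂ hx hf1 hf2 hi1 hi2 e1 e2
    have h1 := fiberCard_add_add_le (g := l) (S := S) hx hf1.symm hf2.symm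
    have h2 := h.col (r f)
    obtain ⟨⟨p, hp, rfl, -⟩, -⟩ := hi1
    have h3 := fiberCard_pos (g := l) (Finset.mem_of_mem_erase hp)
    omega

/-- If removing `f` leaves a full square not meeting the column of `f`, a vertex of the square
can be removed instead. -/
theorem exists_not_isFullSquare_erase {x : X} {y : Y}
    (hrow : ∀ x, 2 * fiberCard l S x ≤ S.card)
    (hcol : ∀ y, 2 * fiberCard r S y ≤ S.card) {f : E} (hf : f ∈ S) (hfx : l f ≠ x)
    (hpair : MeetsTightPairs l r S f) {x₁ x₂ : X} {y₁ y₂ : Y} (hx : x₁ ≠ x₂) (hy : y₁ ≠ y₂)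
    (hin : ∀ p ∈ S.erase f, (l p = x₁ ∨ l p = x₂) ∧ (r p = y₁ ∨ r p = y₂))
    (hbox : ∀ x y, (x = x₁ ∨ x = x₂) → (y = y₁ ∨ y = y₂) → ∃ p ∈ S.erase f, l p = x ∧ r p = y)
    (hrf : r f ≠ y₁ ∧ r f ≠ y₂) :
    ∃ f ∈ S, l f ≠ x ∧ r f ≠ y ∧ MeetsTightPairs l r S f ∧ ¬ IsFullSquare l r (S.erase f) := by
  obtain ⟨w, hw, hwy⟩ : ∃ w, (w = y₁ ∨ w = y₂) ∧ w ≠ y := by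
    by_cases hy1 : y₁ = y
    · exact ⟨y₂, .inr rfl, fun h => hy (hy1.trans h.symm)⟩
    · exact ⟨y₁, .inl rfl, hy1⟩
  obtain ⟨z, hz, hzx, hzf⟩ : ∃ z, (z = x₁ ∨ z = x₂) ∧ z ≠ x ∧
      (z = l f ∨ (l f ≠ x₁ ∧ l f ≠ x₂)) := by
    by_cases hlf : l f = x₁ ∨ l f = x₂
    · exact ⟨l f, hlf, hfx, .inl rfl⟩
    · push Not at hlf
      by_cases hx1 : x₁ = x
      · exact ⟨x₂, .inr rfl, fun h => hx (hx1.trans h.symm), .inr hlf⟩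
      · exact ⟨x₁, .inl rfl, hx1, .inr hlf⟩
  obtain ⟨p₁₁, m₁₁, l₁₁, r₁₁⟩ := hbox x₁ y₁ (.inl rfl) (.inl rfl)
  obtain ⟨p₁₂, m₁₂, l₁₂, r₁₂⟩ := hbox x₁ y₂ (.inl rfl) (.inr rfl)
  obtain ⟨p₂₁, m₂₁, l₂₁, r₂₁⟩ := hbox x₂ y₁ (.inr rfl) (.inl rfl)
  obtain ⟨p₂₂, m₂₂, l₂₂, r₂₂⟩ := hbox x₂ y₂ (.inr rfl) (.inr rfl)
  have hcard : 3 ≤ S.card := by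
    have h1 := Finset.card_erase_add_one hf
    have h2 : 1 < (S.erase f).card := Finset.one_lt_card.2
      ⟨p₁₁, m₁₁, p₂₁, m₂₁, by rintro rfl; exact hx (l₁₁ ▸ l₂₁)⟩
    omega
  have hc1 : fiberCard r S (r f) = 1 := fiberCard_eq_one hf fun p hp hpf => by
    by_contra hpne
    have := (hin p (Finset.mem_erase.2 ⟨hpne, hp⟩)).2
    rw [hpf] at this
    tauto
  obtain ⟨t, ht, ht1, ht2⟩ := hbox z w hz hw
  refine ⟨t, Finset.mem_of_mem_erase ht, by rwa [ht1], by rwa [ht2], fun x' y' hi he => ?_, ?_⟩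
  · rcases hpair x' y' hi he with rfl | rfl
    · rcases hzf with hzf | hzf
      · exact .inl (ht1.trans hzf)
      · exfalso
        have hc2 : fiberCard l S (l f) = 1 := fiberCard_eq_one hf fun p hp hpf => by
          by_contra hpne
          have := (hin p (Finset.mem_erase.2 ⟨hpne, hp⟩)).1
          rw [hpf] at this
          tauto
        have := hcol y'
        omega
    · exfalso
      have := hrow x'
      omega
  · rintro ⟨x₁', x₂', y₁', y₂', -, -, hin', -⟩
    have ht' := Finset.ne_of_mem_erase ht
    have h0 := (hin' f (Finset.mem_erase.2 ⟨ht'.symm, hf⟩)).2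
    have h1 : y₁ = y₁' ∨ y₁ = y₂' := by
      by_cases hcase : p₁₁ = t
      · rw [← r₂₁]
        refine (hin' p₂₁ (Finset.mem_erase.2 ⟨?_, Finset.mem_of_mem_erase m₂₁⟩)).2
        rintro rfl
        exact hx (by rw [← l₁₁, hcase, l₂₁])
      · rw [← r₁₁]
        exact (hin' p₁₁ (Finset.mem_erase.2 ⟨hcase, Finset.mem_of_mem_erase m₁₁⟩)).2
    have h2 : y₂ = y₁' ∨ y₂ = y₂' := by
      by_cases hcase : p₁₂ = t
      · rw [← r₂₂]
        refine (hin' p₂₂ (Finset.mem_erase.2 ⟨?_, Finset.mem_of_mem_erase m₂₂⟩)).2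
        rintro rfl
        exact hx (by rw [← l₁₂, hcase, l₂₂])
      · rw [← r₁₂]
        exact (hin' p₁₂ (Finset.mem_erase.2 ⟨hcase, Finset.mem_of_mem_erase m₁₂⟩)).2
    grind

/-- The induction step when no line contains more than half of the vertices. -/
theorem exists_next_of_small_lines {x : X} {y : Y} (h : IsGood l r S) (hs : IsStart l r S x y)
    (hS : S.Nonempty) (hrow : ∀ x, 2 * fiberCard l S x ≤ S.card)
    (hcol : ∀ y, 2 * fiberCard r S y ≤ S.card) :
    ∃ f ∈ S, l f ≠ x ∧ r f ≠ y ∧ IsGood l r (S.erase f) ∧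
      IsStart l r (S.erase f) (l f) (r f) := by
  obtain ⟨f, hf, hfx, hfy, hpair, hsq⟩ : ∃ f ∈ S, l f ≠ x ∧ r f ≠ y ∧
      MeetsTightPairs l r S f ∧ ¬ IsFullSquare l r (S.erase f) := by
    obtain ⟨f, hf, hfx, hfy, hpair⟩ := exists_meetsTightPairs h hs hS hrow hcol
    by_cases hsq : IsFullSquare l r (S.erase f)
    · obtain ⟨x₁, x₂, y₁, y₂, hx, hy, hin, hbox⟩ := id hsq
      by_cases hrf : r f ≠ y₁ ∧ r f ≠ y₂
      · exact exists_not_isFullSquare_erase hrow hcol hf hfx hpair hx hy hin hbox hrf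
      · have hlf : l f ≠ x₁ ∧ l f ≠ x₂ := by
          by_contra hlf
          refine h.not_square ⟨x₁, x₂, y₁, y₂, hx, hy, fun p hp => ?_, fun x y hx hy => ?_⟩
          · by_cases hpf : p = f
            · subst hpf
              tauto
            · exact hin p (Finset.mem_erase.2 ⟨hpf, hp⟩)
          · obtain ⟨p, hp, h⟩ := hbox x y hx hy
            exact ⟨p, Finset.mem_of_mem_erase hp, h⟩
        obtain ⟨f, hf, h1, h2, h3, h4⟩ := exists_not_isFullSquare_erase (l := r) (r := l) (y := x)
          hcol hrow hf hfy hpair.swap hy hx (fun p hp => (hin p hp).symm)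
          (fun y x hy hx => by
            obtain ⟨p, hp, h⟩ := hbox x y hx hy
            exact ⟨p, hp, h.symm⟩) hlf
        exact ⟨f, hf, h2, h1, h3.swap, fun h => h4 h.swap⟩
    · exact ⟨f, hf, hfx, hfy, hpair, hsq⟩
  have hl := fiberCard_pos (g := l) hf
  have hr := fiberCard_pos (g := r) hf
  refine ⟨f, hf, hfx, hfy, h.erase hf (fun x hx => ?_) (fun y hy => ?_) hpair hsq,
    isStart_erase hf h (fun y₁ y₂ hy n₁ n₂ _ _ e₁ e₂ => ?_) fun x₁ x₂ hx n₁ n₂ _ _ e₁ e₂ => ?_⟩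
  · have := hrow x
    omega
  · have := hcol y
    omega
  · have h1 := fiberCard_add_add_le (g := r) (S := S) hy n₁.symm n₂.symm
    have := hrow (l f)
    omega
  · have h1 := fiberCard_add_add_le (g := l) (S := S) hx n₁.symm n₂.symm
    have := hcol (r f)
    omega

theorem exists_next {x : X} {y : Y} (h : IsGood l r S) (hs : IsStart l r S x y)
    (hS : S.Nonempty) :
    ∃ f ∈ S, l f ≠ x ∧ r f ≠ y ∧ IsGood l r (S.erase f) ∧
      IsStart l r (S.erase f) (l f) (r f) := by
  by_cases hrow : ∀ x, 2 * fiberCard l S x ≤ S.card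
  · by_cases hcol : ∀ y, 2 * fiberCard r S y ≤ S.card
    · exact exists_next_of_small_lines h hs hS hrow hcol
    · push Not at hcol
      obtain ⟨y₀, hy₀⟩ := hcol
      obtain ⟨f, hf, h1, h2, h3, h4⟩ := exists_next_of_large_row h.swap hs.swap (x₀ := y₀)
        (by have := h.col y₀; omega)
      exact ⟨f, hf, h2, h1, h3.swap, h4.swap⟩
  · push Not at hrow
    obtain ⟨x₀, hx₀⟩ := hrow
    exact exists_next_of_large_row h hs (x₀ := x₀) (by have := h.row x₀; omega)

/-- A good table can be traversed by a path whose successive vertices differ in row and column. -/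
theorem exists_list_isChain {x : X} {y : Y} (h : IsGood l r S) (hs : IsStart l r S x y) :
    ∃ L : List E, L.Nodup ∧ (∀ e, e ∈ L ↔ e ∈ S) ∧
      L.IsChain (fun a b => l a ≠ l b ∧ r a ≠ r b) ∧ ∀ a ∈ L.head?, l a ≠ x ∧ r a ≠ y := by
  induction hn : S.card generalizing S x y with
  | zero =>
    rw [Finset.card_eq_zero] at hn
    subst hn
    exact ⟨[], by simp⟩
  | succ n ih =>
    obtain ⟨f, hf, hfx, hfy, hg, hst⟩ := exists_next h hs (Finset.card_pos.1 (by omega))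
    have hcard := Finset.card_erase_add_one hf
    obtain ⟨L, hnd, hmem, hch, hhead⟩ := ih hg hst (by omega)
    refine ⟨f :: L, ?_, ?_, ?_, ?_⟩
    · exact List.nodup_cons.2 ⟨by simp [hmem], hnd⟩
    · intro e
      simp only [List.mem_cons, hmem, Finset.mem_erase]
      constructor
      · rintro (rfl | h)
        exacts [hf, h.2]
      · tauto
    · rw [List.isChain_cons]
      exact ⟨fun a ha => ⟨(hhead a ha).1.symm, (hhead a ha).2.symm⟩, hch⟩
    · simpa using ⟨hfx, hfy⟩

end Table

namespace SimpleGraph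

variable {V : Type*}

/-- The list `M` traverses paths of `G`, separated by the entries `none`. -/
def IsBrokenPath (G : SimpleGraph V) (M : List (Option V)) : Prop :=
  M.IsChain fun a b => ∀ u ∈ a, ∀ v ∈ b, G.Adj u v

theorem isBrokenPath_flatMap {G : SimpleGraph V} {Q : List (List V)}
    (hQ : ∀ q ∈ Q, q.IsChain G.Adj) :
    G.IsBrokenPath (Q.flatMap fun q => none :: q.map some) := by
  unfold IsBrokenPath
  induction Q with
  | nil => simp
  | cons q Q ih =>
    rw [List.flatMap_cons, List.isChain_append]
    refine ⟨?_, ih fun q hq => hQ q (List.mem_cons_of_mem _ hq), ?_⟩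
    · rw [List.isChain_cons, List.isChain_map]
      exact ⟨by simp, (hQ q List.mem_cons_self).imp fun a b h => by simpa using h⟩
    · intro x _ y hy
      cases Q with
      | nil => simp at hy
      | cons q' Q =>
        obtain rfl : none = y := by simpa using hy
        simp

/-- Cutting a broken path at its entries `none`. -/
theorem IsBrokenPath.exists_pieces {G : SimpleGraph V} {M : List (Option V)}
    (hM : G.IsBrokenPath M) :
    ∃ P : List (List V), P.length + M.reduceOption.length = M.length + 1 ∧
      (∀ q ∈ P, q.IsChain G.Adj) ∧ P.flatten = M.reduceOption ∧
      ∀ v ∈ P.head?.bind List.head?, M.head? = some (some v) := by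
  unfold IsBrokenPath at hM
  induction M with
  | nil => exact ⟨[[]], by simp⟩
  | cons a M ih =>
    rw [List.isChain_cons] at hM
    obtain ⟨P, hlen, hch, hflat, hhead⟩ := ih hM.2
    cases a with
    | none =>
      refine ⟨[] :: P, ?_, ?_, ?_, ?_⟩
      · rw [List.reduceOption_cons_of_none, List.length_cons, List.length_cons]
        omega
      · simpa using hch
      · simpa [List.reduceOption_cons_of_none] using hflat
      · simp
    | some u =>
      cases P with
      | nil =>
        have := List.reduceOption_length_le M
        simp at hlen
        omega
      | cons q P =>
        refine ⟨(u :: q) :: P, ?_, ?_, ?_, ?_⟩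
        · rw [List.reduceOption_cons_of_some]
          simp only [List.length_cons] at hlen ⊢
          omega
        · simp only [List.mem_cons, forall_eq_or_imp] at hch ⊢
          refine ⟨?_, hch.2⟩
          rw [List.isChain_cons]
          refine ⟨fun v hv => ?_, hch.1⟩
          exact hM.1 (some v) (by simpa using hhead v (by simpa using hv)) u rfl v rfl
        · simpa [List.reduceOption_cons_of_some] using hflat
        · simp

theorem hasPathCover_of_flatten {G : SimpleGraph V} {P : List (List V)} (hne : [] ∉ P)
    (hch : ∀ q ∈ P, q.IsChain G.Adj) (hnd : P.flatten.Nodup) (hall : ∀ v, v ∈ P.flatten) :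
    G.HasPathCover P.length := by
  have hne' : ∀ i : Fin P.length, P[i] ≠ [] := fun i h => hne (h ▸ List.getElem_mem _)
  rw [List.nodup_flatten, List.pairwise_iff_getElem] at hnd
  refine ⟨fun i => P[i].head (hne' i), fun i => P[i].getLast (hne' i),
    fun i => Walk.ofSupport P[i] (hne' i) (hch _ (List.getElem_mem _)), fun i => ?_,
    fun i j hij => ?_, fun v => ?_⟩
  · rw [Walk.isPath_def, Walk.support_ofSupport]
    exact hnd.1 _ (List.getElem_mem _)
  · rw [Walk.support_ofSupport, Walk.support_ofSupport]
    rcases lt_or_gt_of_ne hij with h | h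
    · exact hnd.2 i j i.2 j.2 h
    · exact (hnd.2 j i j.2 i.2 h).symm
  · obtain ⟨q, hq, hv⟩ := List.mem_flatten.1 (hall v)
    obtain ⟨i, hi, rfl⟩ := List.getElem_of_mem hq
    exact ⟨⟨i, hi⟩, by rwa [Walk.support_ofSupport]⟩

theorem IsBrokenPath.pathCoveringNumber_le {G : SimpleGraph V} {M : List (Option V)}
    (hM : G.IsBrokenPath M) (hnd : M.reduceOption.Nodup) (hall : ∀ v, some v ∈ M) :
    G.pathCoveringNumber + M.reduceOption.length ≤ M.length + 1 := by
  classical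
  obtain ⟨P, hlen, hch, hflat, -⟩ := hM.exists_pieces
  have hflat' : (P.filter (· ≠ [])).flatten = P.flatten := by
    simp only [List.flatten_filter_ne_nil]
  have hcov : G.HasPathCover (P.filter (· ≠ [])).length := by
    refine hasPathCover_of_flatten (by simp) (fun q hq => hch q (List.mem_of_mem_filter hq)) ?_ ?_
    · rwa [hflat', hflat]
    · intro v
      rw [hflat', hflat, List.reduceOption_mem_iff]
      exact hall v
  have h1 : G.pathCoveringNumber ≤ _ := Nat.sInf_le hcov
  have h2 := List.length_filter_le (· ≠ []) P
  omega

/-- Numbering the entries of a broken path of the complement labels a graph. -/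
theorem IsBrokenPath.exists_isLLabeling {F : SimpleGraph V} {M : List (Option V)}
    (hM : Fᶜ.IsBrokenPath M) (hall : ∀ v, some v ∈ M) :
    ∃ f : V → ℕ, (∀ v, f v ≤ M.length - 1) ∧ F.IsLLabeling 2 1 f := by
  classical
  have hlt : ∀ v, M.idxOf (some v) < M.length := fun v => List.idxOf_lt_length_iff.2 (hall v)
  have hinj : ∀ u v, M.idxOf (some u) = M.idxOf (some v) → u = v := fun u v h =>
    Option.some.inj ((List.idxOf_inj (hall u)).1 h)
  have hsucc : ∀ u v, M.idxOf (some v) = M.idxOf (some u) + 1 → ¬ F.Adj u v := by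
    intro u v h
    have h1 := List.isChain_iff_getElem.1 hM (M.idxOf (some u)) (h ▸ hlt v)
    refine ((compl_adj _ _ _).1 (h1 u ?_ v ?_)).2
    · simp
    · simp [← h]
  refine ⟨fun v => M.idxOf (some v), fun v => Nat.le_sub_one_of_lt (hlt v), ?_, ?_⟩
  · intro u v huv
    have h1 := hsucc u v
    have h2 := hsucc v u
    have h3 := hinj u v
    have h4 := huv.ne
    have h5 := huv.symm
    by_contra hcon
    rw [not_le, abs_lt] at hcon
    grind
  · intro u v huv
    have hne : u ≠ v := by
      rintro rfl
      simp at huv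
    have := mt (hinj u v) hne
    have h6 : (M.idxOf (some u) : ℤ) - M.idxOf (some v) ≠ 0 := by omega
    exact_mod_cast Int.one_le_abs h6

theorem HasPathCover.exists_isLLabeling [Fintype V] [Nonempty V] {F : SimpleGraph V} {k : ℕ}
    (h : Fᶜ.HasPathCover k) :
    ∃ f : V → ℕ, (∀ v, f v + 2 ≤ Fintype.card V + k) ∧ F.IsLLabeling 2 1 f := by
  obtain ⟨a, b, p, hp, hdis, hcov⟩ := h
  set Q : List (List V) := (List.finRange k).map fun i => (p i).support with hQ
  have hmem : ∀ v, ∃ q ∈ Q, v ∈ q := fun v => by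
    obtain ⟨i, hi⟩ := hcov v
    exact ⟨_, List.mem_map.2 ⟨i, List.mem_finRange i, rfl⟩, hi⟩
  have hbr : Fᶜ.IsBrokenPath (Q.flatMap fun q => none :: q.map some) := by
    refine isBrokenPath_flatMap fun q hq => ?_
    obtain ⟨i, -, rfl⟩ := List.mem_map.1 hq
    exact (p i).isChain_adj_support
  have hnd : Q.flatten.Nodup := by
    rw [List.nodup_flatten]
    constructor
    · intro q hq
      obtain ⟨i, -, rfl⟩ := List.mem_map.1 hq
      exact (hp i).support_nodup
    · rw [hQ, List.pairwise_map]
      exact (List.nodup_finRange k).imp (fun h => hdis _ _ h)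
  have hlen : (Q.flatMap fun q => none :: q.map some).length = Q.flatten.length + k := by
    have hk : Q.length = k := by simp [hQ]
    rw [← hk]
    clear_value Q
    clear * -
    induction Q with
    | nil => simp
    | cons q Q ih =>
      rw [List.flatMap_cons, List.length_append, ih]
      simp
      omega
  have hcard := hnd.length_le_card
  have hQne : Q ≠ [] := by
    intro h
    obtain ⟨q, hq, -⟩ := hmem (Classical.arbitrary V)
    simp [h] at hq
  obtain ⟨M, hM⟩ : ∃ M, (Q.flatMap fun q => none :: q.map some) = none :: M := by
    obtain ⟨q, Q', hQ'⟩ := List.exists_cons_of_ne_nil hQne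
    rw [hQ', List.flatMap_cons]
    exact ⟨_, rfl⟩
  have hall : ∀ v, some v ∈ M := by
    intro v
    obtain ⟨q, hq, hv⟩ := hmem v
    have h1 : some v ∈ (Q.flatMap fun q => none :: q.map some) :=
      List.mem_flatMap.2 ⟨q, hq, by simpa using hv⟩
    simpa [hM] using h1
  rw [hM] at hbr hlen
  obtain ⟨f, hf, hL⟩ := IsBrokenPath.exists_isLLabeling (List.IsChain.tail hbr) hall
  refine ⟨f, fun v => ?_, hL⟩
  have h1 := hf v
  have h2 := List.length_pos_of_mem (hall v)
  simp only [List.tail_cons, List.length_cons] at h1 hlen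
  omega

end SimpleGraph

/-- Labels of a set with pairwise distinct labels, in which the labels of `B` are at distance at
least two from all others, need room for one more label after each label of `B`. -/
theorem card_add_card_le_of_separated {E : Type*} {f : E → ℕ} {K : ℕ} (hK : ∀ e, f e ≤ K)
    {U B : Finset E} (hB : B ⊆ U) (hinj : Set.InjOn f U)
    (hsep : ∀ b ∈ B, ∀ u ∈ U, f u ≠ f b + 1 ∧ f b ≠ f u + 1) :
    U.card + B.card ≤ K + 2 ∧ (B ≠ U → U.card + B.card ≤ K + 1) := by
  classical
  have hdisj : Disjoint (U.image f) (B.image fun b => f b + 1) := by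
    rw [Finset.disjoint_left]
    intro n hn hn'
    obtain ⟨u, hu, rfl⟩ := Finset.mem_image.1 hn
    obtain ⟨b, hb, hbu⟩ := Finset.mem_image.1 hn'
    exact (hsep b hb u hu).1 hbu.symm
  have hcard : ((U.image f) ∪ (B.image fun b => f b + 1)).card = U.card + B.card := by
    rw [Finset.card_union_of_disjoint hdisj, Finset.card_image_of_injOn hinj,
      Finset.card_image_of_injOn]
    intro a ha b hb hab
    exact hinj (hB ha) (hB hb) (by simpa using hab)
  have hsub : (U.image f) ∪ (B.image fun b => f b + 1) ⊆ Finset.range (K + 2) := by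
    intro n hn
    rw [Finset.mem_range]
    rcases Finset.mem_union.1 hn with hn | hn <;> obtain ⟨u, hu, rfl⟩ := Finset.mem_image.1 hn <;>
      have := hK u <;> omega
  refine ⟨by simpa [hcard] using Finset.card_le_card hsub, fun hne => ?_⟩
  have hex : (U \ B).Nonempty := by
    rw [Finset.sdiff_nonempty]
    exact fun h => hne (hB.antisymm h)
  obtain ⟨u₀, hu₀, hmax⟩ := Finset.exists_max_image _ f hex
  rw [Finset.mem_sdiff] at hu₀
  have hnot : f u₀ + 1 ∉ (U.image f) ∪ (B.image fun b => f b + 1) := by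
    intro hn
    rcases Finset.mem_union.1 hn with hn | hn <;> obtain ⟨u, hu, huf⟩ := Finset.mem_image.1 hn
    · by_cases huB : u ∈ B
      · exact (hsep u huB u₀ hu₀.1).2 huf
      · have := hmax u (Finset.mem_sdiff.2 ⟨hu, huB⟩)
        omega
    · exact hu₀.2 (hinj hu₀.1 (hB hu) (by omega : f u₀ = f u) ▸ hu)
  have h1 := Finset.card_lt_card ((Finset.ssubset_iff_of_subset hsub).2
    ⟨f u₀ + 1, by have := hK u₀; simp; omega, hnot⟩)
  rw [hcard, Finset.card_range] at h1
  omega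

namespace BipartiteMultigraph

variable {X Y E : Type*} {H : BipartiteMultigraph X Y E}

theorem ne_of_adj {f : E → ℕ} (hf : H.lineGraph.IsLLabeling 2 1 f) {u v : E}
    (h : H.lineGraph.Adj u v) : f u ≠ f v ∧ f u ≠ f v + 1 ∧ f v ≠ f u + 1 := by
  have := hf.1 u v h
  refine ⟨?_, ?_, ?_⟩ <;> intro h <;> rw [h] at this <;> simp at this

theorem two_mul_card_le_of_pairwise_adj {f : E → ℕ} {K : ℕ} (hK : ∀ e, f e ≤ K)
    (hf : H.lineGraph.IsLLabeling 2 1 f) {A : Finset E}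
    (hA : ∀ u ∈ A, ∀ v ∈ A, u ≠ v → H.lineGraph.Adj u v) : 2 * A.card ≤ K + 2 := by
  have h1 := (card_add_card_le_of_separated hK (subset_refl A) ?_ ?_).1
  · omega
  · intro u hu v hv huv
    by_contra hne
    exact (ne_of_adj hf (hA u hu v hv hne)).1 huv
  · intro u hu v hv
    by_cases h : u = v
    · subst h
      omega
    · have := ne_of_adj hf (hA u hu v hv h)
      omega

/-- The row of a vertex in the table extended by `d` vertices in rows and columns of their own. -/
def extLeft (H : BipartiteMultigraph X Y E) (d : ℕ) : E ⊕ Fin d → X ⊕ ℕ := Sum.map H.left Fin.val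

/-- The column of a vertex in the table extended by `d` vertices in rows and columns of their
own. -/
def extRight (H : BipartiteMultigraph X Y E) (d : ℕ) : E ⊕ Fin d → Y ⊕ ℕ := Sum.map H.right Fin.val

variable [Fintype E]

theorem mem_row {x : X} {e : E} : e ∈ H.row x ↔ H.left e = x := by
  simp [row]

theorem mem_col {y : Y} {e : E} : e ∈ H.col y ↔ H.right e = y := by
  simp [col]

theorem fiberCard_left [DecidableEq X] (x : X) : fiberCard H.left Finset.univ x = (H.row x).card := by
  unfold fiberCard
  congr 1
  ext e
  simp [mem_row]

theorem fiberCard_right [DecidableEq Y] (y : Y) : fiberCard H.right Finset.univ y = (H.col y).card := by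
  unfold fiberCard
  congr 1
  ext e
  simp [mem_col]

theorem row_card_add_col_card_le {f : E → ℕ} {K : ℕ} (hK : ∀ e, f e ≤ K)
    (hf : H.lineGraph.IsLLabeling 2 1 f) {x : X} {y : Y}
    (hxy : ¬ H.row x ⊆ H.col y) (hn : Fintype.card E < (H.row x).card + (H.col y).card) :
    (H.row x).card + (H.col y).card ≤ K + 1 := by
  classical
  rw [← Finset.card_union_add_card_inter]
  rw [← Finset.card_union_add_card_inter] at hn
  have hadj : ∀ b ∈ H.row x ∩ H.col y, ∀ u ∈ H.row x ∪ H.col y, u ≠ b →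
      H.lineGraph.Adj u b := by
    intro b hb u hu hne
    simp only [Finset.mem_inter, Finset.mem_union, mem_row, mem_col] at hb hu
    refine ⟨hne, ?_⟩
    rw [hb.1, hb.2]
    exact hu
  refine (card_add_card_le_of_separated hK
    (Finset.inter_subset_left.trans Finset.subset_union_left) ?_ ?_).2 ?_
  · intro u hu v hv huv
    by_contra hne
    obtain ⟨b, hb⟩ : (H.row x ∩ H.col y).Nonempty := by
      rw [← Finset.card_pos]
      have := Finset.card_le_univ (H.row x ∪ H.col y)
      omega
    by_cases hadj' : H.lineGraph.Adj u v
    · exact (ne_of_adj hf hadj').1 huv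
    have hub : u ≠ b := by
      rintro rfl
      exact hadj' (hadj u hb v hv (Ne.symm hne)).symm
    have hvb : v ≠ b := by
      rintro rfl
      exact hadj' (hadj v hb u hu hne)
    have hdist : H.lineGraph.dist u v = 2 := by
      rw [SimpleGraph.dist, SimpleGraph.edist_eq_two_iff.2 ⟨hne, hadj', b, hadj b hb u hu hub,
        hadj b hb v hv hvb⟩]
      rfl
    have := hf.2 u v hdist
    simp [huv] at this
  · intro b hb u hu
    by_cases h : u = b
    · subst h
      omega
    · have := ne_of_adj hf (hadj b hb u hu h)
      omega
  · intro h
    exact hxy fun e he => (Finset.mem_inter.1 (h ▸ Finset.mem_union_left _ he :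
      e ∈ H.row x ∩ H.col y)).2

theorem mult_add_mult_left {x : X} {y₁ y₂ : Y} (hy : y₁ ≠ y₂)
    (hr : ∀ e, H.right e = y₁ ∨ H.right e = y₂) :
    H.mult x y₁ + H.mult x y₂ = (H.row x).card := by
  classical
  unfold mult
  rw [← Finset.card_union_of_disjoint]
  · refine congrArg Finset.card (Finset.ext fun e => ?_)
    have := hr e
    simp [mem_row]
    tauto
  · rw [Finset.disjoint_filter]
    rintro e - ⟨-, rfl⟩ h
    exact hy h.2

theorem mult_add_mult_right {y : Y} {x₁ x₂ : X} (hx : x₁ ≠ x₂)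
    (hl : ∀ e, H.left e = x₁ ∨ H.left e = x₂) :
    H.mult x₁ y + H.mult x₂ y = (H.col y).card := by
  classical
  unfold mult
  rw [← Finset.card_union_of_disjoint]
  · refine congrArg Finset.card (Finset.ext fun e => ?_)
    have := hl e
    simp [mem_col]
    tauto
  · rw [Finset.disjoint_filter]
    rintro e - ⟨rfl, -⟩ h
    exact hx h.1

theorem row_card_add_row_card {x₁ x₂ : X} (hx : x₁ ≠ x₂)
    (hl : ∀ e, H.left e = x₁ ∨ H.left e = x₂) :
    (H.row x₁).card + (H.row x₂).card = Fintype.card E := by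
  classical
  rw [← Finset.card_union_of_disjoint, ← Finset.card_univ]
  · congr 1
    ext e
    have := hl e
    simp [mem_row]
    tauto
  · rw [Finset.disjoint_left]
    intro e h1 h2
    exact hx ((mem_row.1 h1).symm.trans (mem_row.1 h2))

theorem IsBalancedSquare.row_card_le (h : H.IsBalancedSquare) (x : X) :
    2 * (H.row x).card ≤ Fintype.card E := by
  obtain ⟨x₁, x₂, y₁, y₂, hx, hy, hbox, h1, h2⟩ := h
  have hin : ∀ e, (H.left e = x₁ ∨ H.left e = x₂) ∧ (H.right e = y₁ ∨ H.right e = y₂) :=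
    fun e => (hbox _ _).1 (Finset.card_pos.2 ⟨e, by simp⟩)
  have b1 := mult_add_mult_left (x := x₁) hy fun e => (hin e).2
  have b2 := mult_add_mult_left (x := x₂) hy fun e => (hin e).2
  have b3 := row_card_add_row_card hx fun e => (hin e).1
  rcases (H.row x).eq_empty_or_nonempty with he | ⟨e, he⟩
  · simp [he]
  · rw [mem_row] at he
    rcases he ▸ (hin e).1 with rfl | rfl <;> omega

theorem IsBalancedSquare.col_card_le (h : H.IsBalancedSquare) (y : Y) :
    2 * (H.col y).card ≤ Fintype.card E := by
  obtain ⟨x₁, x₂, y₁, y₂, hx, hy, hbox, h1, h2⟩ := h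
  have hin : ∀ e, (H.left e = x₁ ∨ H.left e = x₂) ∧ (H.right e = y₁ ∨ H.right e = y₂) :=
    fun e => (hbox _ _).1 (Finset.card_pos.2 ⟨e, by simp⟩)
  have b1 := mult_add_mult_left (x := x₁) hy fun e => (hin e).2
  have b2 := mult_add_mult_left (x := x₂) hy fun e => (hin e).2
  have b3 := mult_add_mult_right (y := y₁) hx fun e => (hin e).1
  have b4 := mult_add_mult_right (y := y₂) hx fun e => (hin e).1
  have b5 := row_card_add_row_card hx fun e => (hin e).1
  rcases (H.col y).eq_empty_or_nonempty with he | ⟨e, he⟩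
  · simp [he]
  · rw [mem_col] at he
    rcases he ▸ (hin e).2 with rfl | rfl <;> omega

theorem not_row_subset_col {d : ℕ} {x : X} {y : Y}
    (h : Table.Incomparable (H.extLeft d) (H.extRight d) Finset.univ (Sum.inl x) (Sum.inl y)) :
    ¬ H.row x ⊆ H.col y ∧ ¬ H.col y ⊆ H.row x := by
  obtain ⟨⟨p | p, -, hp⟩, q | q, -, hq⟩ := h <;> simp [extLeft, extRight] at hp hq
  exact ⟨fun h => hp.2 (mem_col.1 (h (mem_row.2 hp.1))),
    fun h => hq.2 (mem_row.1 (h (mem_col.2 hq.1)))⟩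

section Extension

open Table

variable [DecidableEq X] [DecidableEq Y]

theorem isStart_ext (d : ℕ) :
    IsStart (H.extLeft d) (H.extRight d) Finset.univ (Sum.inr d) (Sum.inr d) := by
  have hrow : ∀ y, ¬ Incomparable (H.extLeft d) (H.extRight d) Finset.univ (Sum.inr d) y := by
    rintro y ⟨⟨p | p, -, hp⟩, -⟩ <;> simp [extLeft] at hp
    exact p.2.ne hp.1
  have hcol : ∀ x, ¬ Incomparable (H.extLeft d) (H.extRight d) Finset.univ x (Sum.inr d) := by
    rintro y ⟨-, p | p, -, hp⟩ <;> simp [extRight] at hp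
    exact p.2.ne hp.1
  refine ⟨?_, ?_, fun h => absurd h (hrow _), fun _ _ _ h => absurd h (hrow _),
    fun _ _ _ h => absurd h (hcol _)⟩
  · simp [extLeft, fiberCard_map_inr_self]
  · simp [extRight, fiberCard_map_inr_self]

end Extension

variable [Fintype X] [Fintype Y]

theorem deficit_nonneg (H : BipartiteMultigraph X Y E) : 0 ≤ H.deficit := by
  have := Finset.le_max' _ _ (Finset.mem_insert_self (Fintype.card E : ℤ) H.deficitTerms)
  unfold deficit
  omega

theorem le_of_mem_deficitTerms {t : ℤ} (ht : t ∈ H.deficitTerms) :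
    t ≤ Fintype.card E + H.deficit := by
  have := Finset.le_max' _ _ (Finset.mem_insert_of_mem (b := (Fintype.card E : ℤ)) ht)
  unfold deficit
  omega

theorem row_card_le (x : X) : 2 * ((H.row x).card : ℤ) ≤ Fintype.card E + H.deficit + 1 := by
  have := le_of_mem_deficitTerms (H := H) (t := 2 * ((H.row x).card : ℤ) - 1) (by
    unfold deficitTerms
    simp)
  omega

theorem col_card_le (y : Y) : 2 * ((H.col y).card : ℤ) ≤ Fintype.card E + H.deficit + 1 := by
  have := le_of_mem_deficitTerms (H := H) (t := 2 * ((H.col y).card : ℤ) - 1) (by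
    unfold deficitTerms
    simp)
  omega

theorem row_add_col_card_le {x : X} {y : Y} (h₁ : ¬ H.row x ⊆ H.col y)
    (h₂ : ¬ H.col y ⊆ H.row x) :
    ((H.row x).card : ℤ) + (H.col y).card ≤ Fintype.card E + H.deficit := by
  refine le_of_mem_deficitTerms ?_
  unfold deficitTerms
  refine Finset.mem_union_right _ (Finset.mem_image.2 ⟨(x, y), ?_, rfl⟩)
  simp [h₁, h₂]

/-- A labeling of the line graph uses at least `|G| + DF(G)` labels if the deficit is positive. -/
theorem deficit_le_of_isLLabeling (hd : 1 ≤ H.deficit) {f : E → ℕ} {K : ℕ} (hK : ∀ e, f e ≤ K)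
    (hf : H.lineGraph.IsLLabeling 2 1 f) : Fintype.card E + H.deficit ≤ K + 1 := by
  have hmem := Finset.max'_mem _ (Finset.insert_nonempty (Fintype.card E : ℤ) H.deficitTerms)
  have hmax : (insert (Fintype.card E : ℤ) H.deficitTerms).max' (Finset.insert_nonempty _ _) =
      Fintype.card E + H.deficit := by
    unfold deficit
    omega
  rw [hmax, Finset.mem_insert] at hmem
  rcases hmem with hmem | hmem
  · omega
  unfold deficitTerms at hmem
  simp only [Finset.mem_union, Finset.mem_image, Finset.mem_univ, true_and, Finset.mem_filter] at hmem
  rcases hmem with (⟨x, hx⟩ | ⟨y, hy⟩) | ⟨⟨x, y⟩, ⟨h1, h2⟩, h3⟩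
  · have := two_mul_card_le_of_pairwise_adj hK hf (A := H.row x) fun u hu v hv h =>
      ⟨h, .inl ((mem_row.1 hu).trans (mem_row.1 hv).symm)⟩
    omega
  · have := two_mul_card_le_of_pairwise_adj hK hf (A := H.col y) fun u hu v hv h =>
      ⟨h, .inr ((mem_col.1 hu).trans (mem_col.1 hv).symm)⟩
    omega
  · have := row_card_add_col_card_le hK hf h1 (by omega)
    omega

theorem deficit_lt_of_hasPathCover [Nonempty E] {k : ℕ} (h : H.skewGraph.HasPathCover k) :
    H.deficit < k := by
  obtain ⟨f, hf, hL⟩ := h.exists_isLLabeling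
  have hv := hf (Classical.arbitrary E)
  by_cases hd : 1 ≤ H.deficit
  · have := deficit_le_of_isLLabeling hd (K := Fintype.card E + k - 2)
      (fun e => by have := hf e; omega) hL
    omega
  · obtain ⟨a, b, p, -, -, hcov⟩ := h
    obtain ⟨i, -⟩ := hcov (Classical.arbitrary E)
    have := i.pos
    omega

theorem IsBalancedSquare.deficit_eq_zero (h : H.IsBalancedSquare) : H.deficit = 0 := by
  refine le_antisymm ?_ H.deficit_nonneg
  unfold deficit
  rw [sub_nonpos, Finset.max'_le_iff]
  intro t ht
  unfold deficitTerms at ht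
  simp only [Finset.mem_insert, Finset.mem_union, Finset.mem_image, Finset.mem_univ, true_and,
    Finset.mem_filter] at ht
  rcases ht with rfl | (⟨x, rfl⟩ | ⟨y, rfl⟩) | ⟨⟨x, y⟩, -, rfl⟩
  · exact le_rfl
  · have := h.row_card_le x
    omega
  · have := h.col_card_le y
    omega
  · have := h.row_card_le x
    have := h.col_card_le y
    simp only
    omega

theorem isBalancedSquare_of_forall (hd : H.deficit = 0) {x₁ x₂ : X} {y₁ y₂ : Y} (hx : x₁ ≠ x₂)
    (hy : y₁ ≠ y₂) (hl : ∀ e, H.left e = x₁ ∨ H.left e = x₂)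
    (hr : ∀ e, H.right e = y₁ ∨ H.right e = y₂)
    (hbox : ∀ x y, (x = x₁ ∨ x = x₂) → (y = y₁ ∨ y = y₂) → ∃ e, H.left e = x ∧ H.right e = y) :
    H.IsBalancedSquare := by
  have hle : ∀ x x' y y', x ≠ x' → y ≠ y' → (x = x₁ ∨ x = x₂) → (x' = x₁ ∨ x' = x₂) →
      (y = y₁ ∨ y = y₂) → (y' = y₁ ∨ y' = y₂) →
      ((H.row x).card : ℤ) + (H.col y).card ≤ Fintype.card E := by
    intro x x' y y' hxx hyy h1 h2 h3 h4
    obtain ⟨e, he1, he2⟩ := hbox x y' h1 h4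
    obtain ⟨e', he1', he2'⟩ := hbox x' y h2 h3
    have := row_add_col_card_le (H := H) (x := x) (y := y)
      (fun h => hyy ((mem_col.1 (h (mem_row.2 he1))).symm.trans he2))
      (fun h => hxx ((mem_row.1 (h (mem_col.2 he2'))).symm.trans he1'))
    omega
  have a1 := hle x₁ x₂ y₁ y₂ hx hy (.inl rfl) (.inr rfl) (.inl rfl) (.inr rfl)
  have a2 := hle x₁ x₂ y₂ y₁ hx hy.symm (.inl rfl) (.inr rfl) (.inr rfl) (.inl rfl)
  have a3 := hle x₂ x₁ y₁ y₂ hx.symm hy (.inr rfl) (.inl rfl) (.inl rfl) (.inr rfl)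
  have a4 := hle x₂ x₁ y₂ y₁ hx.symm hy.symm (.inr rfl) (.inl rfl) (.inr rfl) (.inl rfl)
  have b1 := mult_add_mult_left (x := x₁) hy hr
  have b2 := mult_add_mult_left (x := x₂) hy hr
  have b3 := mult_add_mult_right (y := y₁) hx hl
  have b4 := mult_add_mult_right (y := y₂) hx hl
  have b5 := row_card_add_row_card hx hl
  refine ⟨x₁, x₂, y₁, y₂, hx, hy, fun x y => ⟨fun h => ?_, fun h => ?_⟩, by omega, by omega⟩
  · obtain ⟨e, he⟩ := Finset.card_pos.1 h
    simp only [Finset.mem_filter, Finset.mem_univ, true_and] at he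
    rw [← he.1, ← he.2]
    exact ⟨hl e, hr e⟩
  · obtain ⟨e, he⟩ := hbox x y h.1 h.2
    exact Finset.card_pos.2 ⟨e, by simp [he]⟩

section Extension

open Table

variable [DecidableEq X] [DecidableEq Y]

theorem extPair_le [Nonempty E] {d : ℕ} (hd : (d : ℤ) = H.deficit) {x : X ⊕ ℕ} {y : Y ⊕ ℕ}
    (hi : Incomparable (H.extLeft d) (H.extRight d) Finset.univ x y) :
    fiberCard (H.extLeft d) Finset.univ x + fiberCard (H.extRight d) Finset.univ y ≤
      (Finset.univ : Finset (E ⊕ Fin d)).card := by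
  by_cases hdis : ∀ p ∈ Finset.univ, H.extLeft d p = x → H.extRight d p ≠ y
  · exact fiberCard_add_le_of_forall_not hdis
  push Not at hdis
  obtain ⟨e | i, -, rfl, rfl⟩ := hdis
  · have h1 := not_row_subset_col hi
    have h2 := row_add_col_card_le h1.1 h1.2
    simp only [extLeft, extRight, Sum.map_inl, fiberCard_map_inl, fiberCard_left, fiberCard_right,
      Finset.card_univ, Fintype.card_sum, Fintype.card_fin]
    omega
  · exfalso
    obtain ⟨p | p, -, hp⟩ := hi.1 <;> simp [extLeft, extRight] at hp

theorem isGood_ext [Nonempty E] (hsq : ¬ H.IsBalancedSquare) {d : ℕ} (hd : (d : ℤ) = H.deficit) :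
    IsGood (H.extLeft d) (H.extRight d) Finset.univ where
  row x := by
    have hpos := Fintype.card_pos (α := E)
    rcases x with x | i
    · have := row_card_le (H := H) x
      simp only [extLeft, fiberCard_map_inl, fiberCard_left, Finset.card_univ, Fintype.card_sum,
        Fintype.card_fin]
      omega
    · have := fiberCard_map_inr_le H.left d i
      simp only [extLeft, Finset.card_univ, Fintype.card_sum, Fintype.card_fin]
      omega
  col y := by
    have hpos := Fintype.card_pos (α := E)
    rcases y with y | i
    · have := col_card_le (H := H) y
      simp only [extRight, fiberCard_map_inl, fiberCard_right, Finset.card_univ, Fintype.card_sum,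
        Fintype.card_fin]
      omega
    · have := fiberCard_map_inr_le H.right d i
      simp only [extRight, Finset.card_univ, Fintype.card_sum, Fintype.card_fin]
      omega
  pair x y hi := extPair_le hd hi
  not_square := by
    rintro ⟨x₁, x₂, y₁, y₂, hx, hy, hin, hbox⟩
    have key : ∀ p : E ⊕ Fin d, ∃ e, p = Sum.inl e := by
      rintro (e | i)
      · exact ⟨e, rfl⟩
      exfalso
      have h1 := (hin (Sum.inr i) (Finset.mem_univ _)).1
      obtain ⟨p, -, hp1, hp2⟩ := hbox _ y₁ h1 (.inl rfl)
      obtain ⟨q, -, hq1, hq2⟩ := hbox _ y₂ h1 (.inr rfl)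
      rcases p with p | p <;> rcases q with q | q <;> simp [extLeft] at hp1 hq1
      apply hy
      rw [← hp2, ← hq2]
      simp [extRight, hp1, hq1]
    have hd0 : d = 0 := by
      rcases Nat.eq_zero_or_pos d with h | h
      · exact h
      · obtain ⟨e, he⟩ := key (Sum.inr ⟨0, h⟩)
        simp at he
    subst hd0
    obtain ⟨p, -, rfl, rfl⟩ := hbox x₁ y₁ (.inl rfl) (.inl rfl)
    obtain ⟨q, -, rfl, rfl⟩ := hbox x₂ y₂ (.inr rfl) (.inr rfl)
    obtain ⟨a, rfl⟩ := key p
    obtain ⟨b, rfl⟩ := key q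
    simp only [extLeft, extRight, Sum.map_inl, ne_eq, Sum.inl.injEq] at hx hy
    refine hsq (isBalancedSquare_of_forall (by omega) hx hy (fun e => ?_) (fun e => ?_) ?_)
    · simpa [extLeft] using (hin (Sum.inl e) (Finset.mem_univ _)).1
    · simpa [extRight] using (hin (Sum.inl e) (Finset.mem_univ _)).2
    · intro x y hx hy
      obtain ⟨s, -, hs1, hs2⟩ := hbox (Sum.inl x) (Sum.inl y) (by simpa [extLeft] using hx)
        (by simpa [extRight] using hy)
      obtain ⟨e, rfl⟩ := key s
      exact ⟨e, by simpa [extLeft] using hs1, by simpa [extRight] using hs2⟩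

end Extension

/-- The vertices of a skew graph that is not a balanced square are traversed by a broken path with
`DF(G)` gaps. -/
theorem exists_isBrokenPath [Nonempty E] (hsq : ¬ H.IsBalancedSquare) :
    ∃ M : List (Option E), H.skewGraph.IsBrokenPath M ∧ M.reduceOption.Nodup ∧
      (∀ e, some e ∈ M) ∧ (M.length : ℤ) = Fintype.card E + H.deficit := by
  classical
  obtain ⟨d, hd⟩ := Int.eq_ofNat_of_zero_le H.deficit_nonneg
  obtain ⟨L, hnd, hmem, hch, -⟩ :=
    Table.exists_list_isChain (isGood_ext hsq hd.symm) (isStart_ext (H := H) d)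
  refine ⟨L.map Sum.getLeft?, ?_, ?_, ?_, ?_⟩
  · unfold SimpleGraph.IsBrokenPath
    rw [List.isChain_map]
    refine hch.imp ?_
    rintro (a | a) (b | b) hab <;> simp [extLeft, extRight] at hab ⊢
    exact (H.skewGraph_adj a b).2 hab
  · rw [List.reduceOption, List.filterMap_map]
    refine hnd.filterMap ?_
    rintro (a | a) (b | b) e <;> simp
    rintro rfl rfl
    rfl
  · exact fun e => List.mem_map.2 ⟨Sum.inl e, by simp [hmem], rfl⟩
  · have h1 : L.toFinset = Finset.univ := by
      ext e
      simp [hmem]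
    have h2 := List.toFinset_card_of_nodup hnd
    rw [h1] at h2
    simp at h2
    rw [List.length_map, hd, ← h2]
    simp

theorem card_le_reduceOption_length {M : List (Option E)} (hall : ∀ e, some e ∈ M) :
    Fintype.card E ≤ M.reduceOption.length := by
  classical
  have h1 : M.reduceOption.toFinset = Finset.univ := by
    ext e
    simp [List.reduceOption_mem_iff, hall]
  have h2 := List.toFinset_card_le M.reduceOption
  rwa [h1, Finset.card_univ] at h2

end BipartiteMultigraph

theorem mainTheorem5 {X Y E : Type*} [Fintype X] [Fintype Y] [Fintype E] [Nonempty E]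
    (H : BipartiteMultigraph X Y E) :
    (¬ H.IsBalancedSquare →
      (H.skewGraph.pathCoveringNumber : ℤ) = H.deficit + 1) ∧
    (1 ≤ H.deficit →
      (H.lineGraph.lambdaTwoOne : ℤ) = Fintype.card E + H.deficit - 1) := by
  constructor
  · intro hsq
    obtain ⟨M, hM, hnd, hall, hlen⟩ := H.exists_isBrokenPath hsq
    have h1 := hM.pathCoveringNumber_le hnd hall
    have h2 := BipartiteMultigraph.card_le_reduceOption_length hall
    have h3 := H.deficit_lt_of_hasPathCover (Nat.sInf_mem H.skewGraph.exists_hasPathCover)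
    change H.deficit < (H.skewGraph.pathCoveringNumber : ℤ) at h3
    omega
  · intro hd
    have hsq : ¬ H.IsBalancedSquare := fun h => by
      have := h.deficit_eq_zero
      omega
    obtain ⟨M, hM, hnd, hall, hlen⟩ := H.exists_isBrokenPath hsq
    have hlab := hM.exists_isLLabeling hall
    have h1 : H.lineGraph.lambdaTwoOne ≤ M.length - 1 := Nat.sInf_le hlab
    obtain ⟨f, hf, hL⟩ : ∃ f : E → ℕ, (∀ v, f v ≤ H.lineGraph.lambdaTwoOne) ∧
        H.lineGraph.IsLLabeling 2 1 f := Nat.sInf_mem (s := {k | ∃ f : E → ℕ, (∀ v, f v ≤ k) ∧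
          H.lineGraph.IsLLabeling 2 1 f}) ⟨_, hlab⟩
    have h2 := H.deficit_le_of_isLLabeling hd hf hL
    have h3 := Fintype.card_pos (α := E)
    omega
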